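/- Let $A=(A_{ki})$ be an $m\times n$ matrix with entries in $[0,1]$ with rows $A_1,\dots,A_m$, let $a\in\mathbb R^m$, let $0<\sigma<1$ and $\alpha>\frac{-\ln(1-\sigma)}{\sigma}$ (so $\alpha>1$), and let $\hat x\in[0,1/\alpha)^n$ satisfy $A_k\cdot\hat x\ge a_k$ for all $k=1,\dots,m$. Consider the following algorithm RELAXATION. Initially draw $x_1,\dots,x_n$ independently, $x_i\sim\mathrm{Bernoulli}(\alpha\hat x_i)$. While some constraint $A_k\cdot x\ge a_k$ is violated, let $k$ be the least index with $A_k\cdot x<a_k$ and, for every $i$ with $x_i=0$, independently (of each other and of all earlier draws) redraw $x_i\sim\mathrm{Bernoulli}(\sigma A_{ki}\alpha\hat x_i)$; variables with $x_i=1$ are kept. When all constraints are satisfied, return $x$. Then RELAXATION terminates with probability one, and for every $R\subseteq\{1,\dots,n\}$ the vector $x\in\{0,1\}^n$ that it returns satisfies $$ P\Bigl(\bigwedge_{i\in R}x_i=1\Bigr)\le\prod_{i\in R}\rho_i,\qquad \rho_i=\alpha\hat x_i\Bigl(1+\sigma\sum_{k=1}^m\frac{A_{ki}}{(1-\sigma)^{a_k}e^{\sigma\alpha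 A_k\cdot\hat x}-1}\Bigr), $$ where a summand with vanishing denominator (possible only if $a_k=0=A_k\cdot\hat x$) is read as $0$. -/

import Mathlib

namespace CoveringLP

open scoped ENNReal

noncomputable section

/-- The success probability `q`, clipped to `[0, 1]` so that it always is a probability. For every
parameter in the hypotheses of the theorem the clipping does nothing. -/
def clip (q : ℝ) : ℝ := max 0 (min 1 q)

/-- The probability that a Bernoulli variable with success probability `q` takes the value `b`. -/
def bernoulliWeight (q : ℝ) (b : Bool) : ℝ≥0∞ :=
  if b then ENNReal.ofReal (clip q) else ENNReal.ofReal (1 - clip q)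

theorem sum_bernoulliWeight (q : ℝ) : ∑ b : Bool, bernoulliWeight q b = 1 := by
  have h0 : 0 ≤ clip q := le_max_left _ _
  have h1 : 0 ≤ 1 - clip q :=
    sub_nonneg.2 (max_le zero_le_one (min_le_left _ _))
  simp [bernoulliWeight, ← ENNReal.ofReal_add h0 h1]

theorem sum_prod_bernoulliWeight {n : ℕ} (q : Fin n → ℝ) :
    ∑ y : Fin n → Bool, ∏ i, bernoulliWeight (q i) (y i) = 1 := by
  rw [← Fintype.prod_sum fun i b => bernoulliWeight (q i) b]
  exact Finset.prod_eq_one fun i _ => sum_bernoulliWeight (q i)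

/-- The joint law of independent Bernoulli variables with success probabilities
`q 0, …, q (n - 1)`; a vector in `{0, 1}ⁿ` is a function `Fin n → Bool`. -/
def independentBernoulli {n : ℕ} (q : Fin n → ℝ) : PMF (Fin n → Bool) :=
  PMF.ofFintype (fun y => ∏ i, bernoulliWeight (q i) (y i)) (sum_prod_bernoulliWeight q)

/-- The number `A_k · x` for a zero-one vector `x`. -/
def rowValue {n m : ℕ} (A : Fin m → Fin n → ℝ) (k : Fin m) (x : Fin n → Bool) : ℝ :=
  ∑ i, A k i * (if x i then 1 else 0)

/-- The number `A_k · xhat` for a fractional vector `xhat`. -/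
def fracRowValue {n m : ℕ} (A : Fin m → Fin n → ℝ) (k : Fin m) (xhat : Fin n → ℝ) : ℝ :=
  ∑ i, A k i * xhat i

open Classical in
/-- The set of the constraints `A_k · x ≥ a_k` that `x` violates. -/
def violated {n m : ℕ} (A : Fin m → Fin n → ℝ) (a : Fin m → ℝ) (x : Fin n → Bool) :
    Finset (Fin m) :=
  Finset.univ.filter fun k => rowValue A k x < a k

/-- Resampling constraint `k` in state `x`: independently over all `i`, a variable with `x i = 0`
is redrawn as Bernoulli with parameter `σ * A k i * α * xhat i`, and a variable with `x i = 1`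
remains `1`. -/
def resample {n m : ℕ} (xhat : Fin n → ℝ) (A : Fin m → Fin n → ℝ) (σ α : ℝ)
    (k : Fin m) (x : Fin n → Bool) : PMF (Fin n → Bool) :=
  independentBernoulli fun i => if x i then 1 else σ * A k i * α * xhat i

open Classical in
/-- One iteration of the loop of RELAXATION: if a constraint is violated, then the violated
constraint of least index is resampled; otherwise the algorithm has halted, and the state is
kept. -/
def step {n m : ℕ} (xhat : Fin n → ℝ) (A : Fin m → Fin n → ℝ) (a : Fin m → ℝ) (σ α : ℝ)
    (x : Fin n → Bool) : PMF (Fin n → Bool) :=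
  if h : (violated A a x).Nonempty then resample xhat A σ α ((violated A a x).min' h) x
  else PMF.pure x

/-- The law of the state of RELAXATION after the initial sampling and `t` iterations of its loop
(the state is kept once the algorithm has halted). -/
def run {n m : ℕ} (xhat : Fin n → ℝ) (A : Fin m → Fin n → ℝ) (a : Fin m → ℝ) (σ α : ℝ) :
    ℕ → PMF (Fin n → Bool)
  | 0 => independentBernoulli fun i => α * xhat i
  | t + 1 => (run xhat A a σ α t).bind (step xhat A a σ α)

/-- The probability that RELAXATION halts and that the vector `x` that it returns is in `E`. The
events "halted within `t` iterations with output in `E`" increase with `t`, so the probability of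
their union is the supremum of their probabilities. -/
def outputProb {n m : ℕ} (xhat : Fin n → ℝ) (A : Fin m → Fin n → ℝ) (a : Fin m → ℝ) (σ α : ℝ)
    (E : Set (Fin n → Bool)) : ℝ≥0∞ :=
  ⨆ t : ℕ, (run xhat A a σ α t).toOuterMeasure {x | violated A a x = ∅ ∧ x ∈ E}

/-- The bound `ρ_i` for the probability of `x_i = 1`. -/
def rho {n m : ℕ} (xhat : Fin n → ℝ) (A : Fin m → Fin n → ℝ) (a : Fin m → ℝ) (σ α : ℝ)
    (i : Fin n) : ℝ :=
  α * xhat i * (1 + σ * ∑ k, A k i /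
    ((1 - σ) ^ (a k) * Real.exp (σ * α * fracRowValue A k xhat) - 1))

end

end CoveringLP

namespace CoveringLP

open scoped ENNReal
open Finset

noncomputable section

/-! Write p_i = α x̂_i, τ_ki = σ A_ki and w_k = (1-σ)^(-a_k). If x violates constraint k, then w_k
∏_{x_i=1} (1-τ_ki) ≥ 1 (`one_le_weight_of_violated`), so a resampling of k may be charged this
factor. On a single variable, a charged resampling multiplies the on-state by 1-τ and sends the
off-state to on with weight pτ and to off with weight 1-pτ. Bernoulli(p) is a left eigenvector of
this 2×2 matrix, with eigenvalue 1-pτ. Averaged over the initial draw, a charged resampling of k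
therefore costs s_k = w_k ∏_i (1-p_i τ_ki) ≤ ((1-σ)^(a_k) e^(σα A_k·x̂))⁻¹, in whatever order the
resamplings occur.

To explain why all of R becomes one, some variables of R receive a label (k, j), at most one
variable for each k; only the first j+1 resamplings of k are charged. A variable that turns on in a
charged resampling without being the labelled one needs no label: the weight of `none` already
covers it. Summing over labels gives at most p_i (1 + ∑_k τ_ki ∑_j s_k^(j+1)) for each i ∈ R, and
the geometric series yields ρ_i.

This union bound is run as a potential argument: `resample_potential_le` is the one-step inequality,
`expect_run_totalPotential_le` iterates it back to the initial draw, and `sum_expect_potential_le`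
evaluates the result there. Termination is separate: while a constraint is violated, the expected
number of zeros drops by a uniform amount (`exists_drift`). -/

/-! ### Expectations over finite probability spaces -/

/-- The expectation of a real function under a probability mass function on a finite type. -/
def expect {Ω : Type*} [Fintype Ω] (μ : PMF Ω) (f : Ω → ℝ) : ℝ := ∑ y, (μ y).toReal * f y

theorem expect_mono {Ω : Type*} [Fintype Ω] (μ : PMF Ω) {f g : Ω → ℝ} (h : ∀ y, f y ≤ g y) :
    expect μ f ≤ expect μ g :=
  sum_le_sum fun y _ => mul_le_mul_of_nonneg_left (h y) ENNReal.toReal_nonneg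

theorem expect_sum {Ω β : Type*} [Fintype Ω] (μ : PMF Ω) (s : Finset β) (f : β → Ω → ℝ) :
    expect μ (fun y => ∑ c ∈ s, f c y) = ∑ c ∈ s, expect μ (f c) := by
  simp only [expect, mul_sum]
  exact sum_comm

theorem expect_const_mul {Ω : Type*} [Fintype Ω] (μ : PMF Ω) (r : ℝ) (f : Ω → ℝ) :
    expect μ (fun y => r * f y) = r * expect μ f := by
  simp only [expect, mul_sum]
  exact sum_congr rfl fun y _ => by ring

theorem expect_sub {Ω : Type*} [Fintype Ω] (μ : PMF Ω) (f g : Ω → ℝ) :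
    expect μ (fun y => f y - g y) = expect μ f - expect μ g := by
  simp only [expect, mul_sub, sum_sub_distrib]

theorem expect_nonneg {Ω : Type*} [Fintype Ω] (μ : PMF Ω) {f : Ω → ℝ} (h : ∀ y, 0 ≤ f y) :
    0 ≤ expect μ f :=
  sum_nonneg fun y _ => mul_nonneg ENNReal.toReal_nonneg (h y)

theorem expect_pure {Ω : Type*} [Fintype Ω] (x : Ω) (f : Ω → ℝ) :
    expect (PMF.pure x) f = f x := by
  classical
  simp [expect, PMF.pure_apply, apply_ite ENNReal.toReal]

theorem expect_bind {Ω : Type*} [Fintype Ω] (μ : PMF Ω) (κ : Ω → PMF Ω) (f : Ω → ℝ) :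
    expect (μ.bind κ) f = expect μ fun x => expect (κ x) f := by
  simp only [expect, PMF.bind_apply, tsum_fintype, mul_sum]
  rw [sum_comm]
  refine sum_congr rfl fun y _ => ?_
  rw [ENNReal.toReal_sum fun x _ => ENNReal.mul_ne_top (μ.apply_ne_top x) ((κ x).apply_ne_top y),
    sum_mul]
  exact sum_congr rfl fun x _ => by rw [ENNReal.toReal_mul, mul_assoc]

theorem toOuterMeasure_eq_expect {Ω : Type*} [Fintype Ω] (μ : PMF Ω) (s : Set Ω) :
    μ.toOuterMeasure s = ENNReal.ofReal (expect μ (s.indicator 1)) := by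
  classical
  have h0 : ∀ y, 0 ≤ s.indicator (1 : Ω → ℝ) y :=
    Set.indicator_nonneg fun _ _ => zero_le_one
  rw [PMF.toOuterMeasure_apply_fintype, expect,
    ENNReal.ofReal_sum_of_nonneg fun y _ => mul_nonneg ENNReal.toReal_nonneg (h0 y)]
  refine sum_congr rfl fun y _ => ?_
  by_cases hy : y ∈ s <;> simp [hy, ENNReal.ofReal_toReal (μ.apply_ne_top y)]

theorem expect_one {Ω : Type*} [Fintype Ω] (μ : PMF Ω) : expect μ (fun _ => 1) = 1 := by
  have h := μ.tsum_coe
  rw [tsum_fintype] at h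
  simp only [expect, mul_one]
  rw [← ENNReal.toReal_sum fun x _ => μ.apply_ne_top x, h, ENNReal.toReal_one]

theorem toReal_bernoulliWeight {q : ℝ} (h0 : 0 ≤ q) (h1 : q ≤ 1) (b : Bool) :
    (bernoulliWeight q b).toReal = if b then q else 1 - q := by
  have hc : clip q = q := by simp [clip, h0, h1]
  cases b <;> simp [bernoulliWeight, hc, h0, h1]

theorem expect_independentBernoulli_prod {n : ℕ} {q : Fin n → ℝ} (h0 : ∀ i, 0 ≤ q i)
    (h1 : ∀ i, q i ≤ 1) (f : Fin n → Bool → ℝ) :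
    expect (independentBernoulli q) (fun y => ∏ i, f i (y i)) =
      ∏ i, (q i * f i true + (1 - q i) * f i false) := by
  have h : ∀ i, q i * f i true + (1 - q i) * f i false =
      ∑ b : Bool, (bernoulliWeight (q i) b).toReal * f i b := fun i => by
    simp [toReal_bernoulliWeight (h0 i) (h1 i)]
  simp only [h]
  rw [Fintype.prod_sum]
  refine sum_congr rfl fun y _ => ?_
  rw [prod_mul_distrib, independentBernoulli, PMF.ofFintype_apply, ENNReal.toReal_prod]

theorem expect_independentBernoulli_apply {n : ℕ} {q : Fin n → ℝ} (h0 : ∀ i, 0 ≤ q i)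
    (h1 : ∀ i, q i ≤ 1) (j : Fin n) (f : Bool → ℝ) :
    expect (independentBernoulli q) (fun y => f (y j)) =
      q j * f true + (1 - q j) * f false := by
  have h := expect_independentBernoulli_prod h0 h1 fun i b => if i = j then f b else 1
  have e : ∀ i, (q i * (if i = j then f true else 1) + (1 - q i) * (if i = j then f false else 1)) =
      if i = j then q j * f true + (1 - q j) * f false else 1 := fun i => by
    split_ifs with hi
    · rw [hi]
    · ring
  rw [prod_congr rfl fun i _ => e i] at h
  simpa using h

/-- The mean of `f` after one resampling with success probability `q` of a variable with
value `b`. -/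
def siteMean (q : ℝ) (f : Bool → ℝ) (b : Bool) : ℝ :=
  if b then f true else q * f true + (1 - q) * f false

theorem expect_resample_prod {n m : ℕ} {xhat : Fin n → ℝ} {A : Fin m → Fin n → ℝ} {σ α : ℝ}
    {k : Fin m} (h0 : ∀ i, 0 ≤ σ * A k i * α * xhat i) (h1 : ∀ i, σ * A k i * α * xhat i ≤ 1)
    (x : Fin n → Bool) (f : Fin n → Bool → ℝ) :
    expect (resample xhat A σ α k x) (fun y => ∏ i, f i (y i)) =
      ∏ i, siteMean (σ * A k i * α * xhat i) (f i) (x i) := by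
  rw [resample, expect_independentBernoulli_prod]
  · refine prod_congr rfl fun i _ => ?_
    cases h : x i <;> simp [siteMean]
  · intro i; split_ifs; exacts [zero_le_one, h0 i]
  · intro i; split_ifs; exacts [le_rfl, h1 i]

/-- Expanding a product of sums by the first factor in which the first summand is chosen. -/
theorem prod_add_le_prod_add_sum {ι : Type*} [DecidableEq ι] (s : Finset ι) (a b : ι → ℝ)
    (ha : ∀ i ∈ s, 0 ≤ a i) (hb : ∀ i ∈ s, 0 ≤ b i) :
    ∏ i ∈ s, (a i + b i) ≤ ∏ i ∈ s, b i + ∑ i ∈ s, a i * ∏ j ∈ s.erase i, (a j + b j) := by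
  induction s using Finset.induction_on with
  | empty => simp
  | insert i s hi ih =>
    have ha' : ∀ j ∈ s, 0 ≤ a j := fun j hj => ha j (mem_insert_of_mem hj)
    have hb' : ∀ j ∈ s, 0 ≤ b j := fun j hj => hb j (mem_insert_of_mem hj)
    have hai := ha i (mem_insert_self i s)
    have hbi := hb i (mem_insert_self i s)
    rw [prod_insert hi, prod_insert hi, sum_insert hi, erase_insert hi, add_mul]
    have h1 := mul_le_mul_of_nonneg_left (ih ha' hb') hbi
    have h2 : b i * ∑ j ∈ s, a j * ∏ l ∈ s.erase j, (a l + b l) ≤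
        ∑ j ∈ s, a j * ∏ l ∈ (insert i s).erase j, (a l + b l) := by
      rw [mul_sum]
      refine sum_le_sum fun j hj => ?_
      have hij : i ≠ j := fun e => hi (e ▸ hj)
      rw [erase_insert_of_ne hij, prod_insert fun h => hi (mem_of_mem_erase h)]
      have hP : 0 ≤ ∏ l ∈ s.erase j, (a l + b l) := prod_nonneg fun l hl =>
        add_nonneg (ha' l (mem_of_mem_erase hl)) (hb' l (mem_of_mem_erase hl))
      -- This is exactly the slack: the enlarged erased product carries a i + b i where the left
      -- side has only b i.
      have : 0 ≤ a i * (a j * ∏ l ∈ s.erase j, (a l + b l)) :=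
        mul_nonneg hai (mul_nonneg (ha' j hj) hP)
      nlinarith
    linarith

/-! ### Labels -/

/-- A label of a variable: `some (k, j)` records that the variable is set to one by resampling
number `j + 1` of constraint `k`. -/
abbrev Label (m : ℕ) := Option (Fin m × ℕ)

/-- The number of resamplings of constraint `k` that a label calls for. -/
def Label.count {m : ℕ} (k : Fin m) : Label m → ℕ
  | none => 0
  | some (k', j) => if k' = k then j + 1 else 0

/-- The label with one resampling of constraint `k` less. -/
def Label.dec {m : ℕ} (k : Fin m) : Label m → Label m
  | none => none
  | some (k', 0) => if k' = k then none else some (k', 0)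
  | some (k', j + 1) => if k' = k then some (k', j) else some (k', j + 1)

theorem Label.dec_of_count_eq_zero {m : ℕ} {k : Fin m} {l : Label m} (h : l.count k = 0) :
    l.dec k = l := by
  rcases l with _ | ⟨k', _ | j⟩ <;> simp_all [Label.count, Label.dec]

/-- The number of resamplings of constraint `k` that a labelling calls for. -/
def total {n m : ℕ} (c : Fin n → Label m) (k : Fin m) : ℕ := ∑ i, (c i).count k

theorem total_update {n m : ℕ} (c : Fin n → Label m) (i : Fin n) (l : Label m) (k : Fin m)
    (h : ∀ k', l.count k' = (c i).count k' + if k' = k then 1 else 0) (k' : Fin m) :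
    total (Function.update c i l) k' = total c k' + if k' = k then 1 else 0 := by
  classical
  rw [total, total, ← add_sum_erase _ _ (mem_univ i), ← add_sum_erase univ _ (mem_univ i),
    Function.update_self, h, add_right_comm]
  congr 2
  exact sum_congr rfl fun j hj => by rw [Function.update_of_ne (ne_of_mem_erase hj)]

open Classical in
/-- The labellings that give labels only to variables in `R`, that use each constraint at most
once, and that use only constraints in `K` and at most `t` resamplings of each. -/
def labellings {n m : ℕ} (R : Finset (Fin n)) (K : Finset (Fin m)) (t : ℕ) :
    Finset (Fin n → Label m) :=
  (Fintype.piFinset fun i => if i ∈ R then insertNone (K ×ˢ range t) else {none}).filter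
    fun c => ∀ k i i', (c i).count k ≠ 0 → (c i').count k ≠ 0 → i = i'

theorem mem_labellings {n m : ℕ} {R : Finset (Fin n)} {K : Finset (Fin m)} {t : ℕ}
    {c : Fin n → Label m} :
    c ∈ labellings R K t ↔
      (∀ i k j, c i = some (k, j) → i ∈ R ∧ k ∈ K ∧ j < t) ∧
      ∀ k i i', (c i).count k ≠ 0 → (c i').count k ≠ 0 → i = i' := by
  classical
  rw [labellings, mem_filter, Fintype.mem_piFinset]
  refine and_congr_left fun _ => forall_congr' fun i => ?_
  by_cases hi : i ∈ R
  · simp only [hi, if_true, true_and, mem_insertNone, mem_product, mem_range, Option.mem_def,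
      Prod.forall]
  · simp only [hi, if_false, mem_singleton, false_and]
    rcases c i with _ | ⟨k, j⟩ <;> simp

theorem labellings_mono {n m : ℕ} (R : Finset (Fin n)) (K : Finset (Fin m)) {s t : ℕ}
    (h : s ≤ t) : labellings R K s ⊆ labellings R K t := fun c hc => by
  rw [mem_labellings] at hc ⊢
  exact ⟨fun i k j e => ⟨(hc.1 i k j e).1, (hc.1 i k j e).2.1, (hc.1 i k j e).2.2.trans_le h⟩,
    hc.2⟩

/-- Serves both ways of extending a labelling: labelling a fresh variable when k is unused, and
raising the label of the only variable that uses k. -/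
theorem update_mem_labellings {n m : ℕ} {R : Finset (Fin n)} {K : Finset (Fin m)} {t : ℕ}
    {c : Fin n → Label m} (hc : c ∈ labellings R K t) {i : Fin n} (hi : i ∈ R) {k : Fin m}
    (hk : k ∈ K) {j : ℕ} (hj : j ≤ t) (h : ∀ i', (c i').count k ≠ 0 → i' = i) :
    Function.update c i (some (k, j)) ∈ labellings R K (t + 1) := by
  rw [mem_labellings] at hc ⊢
  have hcount : ∀ k' i', (Function.update c i (some (k, j)) i').count k' ≠ 0 →
      if k' = k then i' = i else (c i').count k' ≠ 0 := by
    intro k' i' h'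
    rcases eq_or_ne i' i with rfl | hne
    · rw [Function.update_self] at h'
      by_cases e : k' = k
      · simp [e]
      · exact absurd (if_neg (Ne.symm e)) h'
    · rw [Function.update_of_ne hne] at h'
      split_ifs with e
      · exact h i' (e ▸ h')
      · exact h'
  constructor
  · intro i' k' j' e
    rcases eq_or_ne i' i with rfl | hne
    · rw [Function.update_self, Option.some.injEq, Prod.mk.injEq] at e
      exact ⟨hi, e.1 ▸ hk, by omega⟩
    · rw [Function.update_of_ne hne] at e
      have := hc.1 i' k' j' e
      exact ⟨this.1, this.2.1, by omega⟩
  · intro k' i1 i2 h1 h2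
    have h1 := hcount k' i1 h1
    have h2 := hcount k' i2 h2
    split_ifs at h1 h2 with e
    · rw [h1, h2]
    · exact hc.2 k' i1 i2 h1 h2

theorem dec_comp_update {n m : ℕ} {c : Fin n → Label m} {i : Fin n} {k : Fin m} {l : Label m}
    (hl : l.dec k = c i) (h : ∀ i', i' ≠ i → (c i').count k = 0) :
    Label.dec k ∘ Function.update c i l = c := by
  funext i'
  rcases eq_or_ne i' i with rfl | hne
  · simpa using hl
  · simpa [hne] using Label.dec_of_count_eq_zero (h i' hne)

/-! ### The weight of a variable -/

/-- The expected weight of a variable with value `b`, when the labelled resamplings are still to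
come. The off-state loses mass by the total factor `B`, the on-state by `C`; `r` tells whether the
variable is required to be one in the end. -/
def factor {m : ℕ} (p : ℝ) (τ : Fin m → ℝ) (r : Bool) (B C : ℝ) (l : Label m) (b : Bool) : ℝ :=
  match l with
  | some (k, _) => if b then 0 else p * τ k * B / (1 - p * τ k)
  | none => if b then C else if r then p * (B - C) / (1 - p) else (B - p * C) / (1 - p)

section factor

variable {m : ℕ} {p : ℝ} {τ : Fin m → ℝ} (hp0 : 0 ≤ p) (hp1 : p < 1) (hτ0 : ∀ k, 0 ≤ τ k)
  (hτ1 : ∀ k, τ k < 1) {B C : ℝ} (hC : 0 ≤ C) (hCB : C ≤ B)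

include hp0 hp1 hτ1 in
theorem one_sub_mul_pos (k : Fin m) : 0 < 1 - p * τ k := by
  nlinarith [hτ1 k]

include hp0 hp1 hτ0 hτ1 hC hCB in
theorem factor_nonneg (r : Bool) (l : Label m) (b : Bool) : 0 ≤ factor p τ r B C l b := by
  have h1 : 0 < 1 - p := sub_pos.2 hp1
  have hB := hC.trans hCB
  rcases l with _ | ⟨k, j⟩
  · cases b <;> cases r <;> simp only [factor, if_true, if_false, Bool.false_eq_true]
    · exact div_nonneg (by nlinarith) h1.le
    · exact div_nonneg (mul_nonneg hp0 (sub_nonneg.2 hCB)) h1.le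
    · exact hC
    · exact hC
  · have := one_sub_mul_pos hp0 hp1 hτ1 k
    cases b <;> simp only [factor, if_true, if_false, Bool.false_eq_true]
    · exact div_nonneg (mul_nonneg (mul_nonneg hp0 (hτ0 k)) hB) this.le
    · exact le_rfl

-- The matrix of a charged resampling has eigenvalues 1-pτ and 1-τ, and its eigenvectors depend only
-- on p. So all these matrices act diagonally on the parameters (B, C), and the order of the charged
-- resamplings is irrelevant. For a labelled variable, which has to stay off, only the off-to-off
-- entry 1-pτ acts.
include hp1 in
theorem siteMean_factor (r : Bool) (l : Label m) (b : Bool) (k : Fin m) :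
    siteMean (p * τ k) (factor p τ r B C l) b * (if b then 1 - τ k else 1) =
      factor p τ r ((1 - p * τ k) * B) ((1 - τ k) * C) l b := by
  have h1 : 1 - p ≠ 0 := (sub_pos.2 hp1).ne'
  rcases l with _ | ⟨k', j⟩
  · cases b <;> cases r <;>
      simp only [factor, siteMean, if_true, if_false, Bool.false_eq_true] <;> field_simp <;> ring
  · cases b <;> simp only [factor, siteMean, if_true, if_false, Bool.false_eq_true] <;> ring

/-- The part of `siteMean` that comes from an unlabelled required variable being set to one. -/
def gain (p τ : ℝ) (r : Bool) (C : ℝ) (l : Label m) (b : Bool) : ℝ :=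
  match l with
  | some _ => 0
  | none => if b then 0 else if r then p * τ * C else 0

include hp0 hτ0 hC in
theorem gain_nonneg (r : Bool) (l : Label m) (b : Bool) (k : Fin m) :
    0 ≤ gain p (τ k) r C l b := by
  have := mul_nonneg (mul_nonneg hp0 (hτ0 k)) hC
  rcases l with _ | _ <;> cases b <;> cases r <;> simp [gain, this]

include hp0 hp1 hτ0 hτ1 hC hCB in
theorem gain_le_siteMean (r : Bool) (l : Label m) (b : Bool) (k : Fin m) :
    gain p (τ k) r C l b ≤ siteMean (p * τ k) (factor p τ r B C l) b := by
  have hf := factor_nonneg hp0 hp1 hτ0 hτ1 hC hCB r l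
  have hq := mul_nonneg hp0 (hτ0 k)
  have hq1 := one_sub_mul_pos hp0 hp1 hτ1 k
  have hs : 0 ≤ siteMean (p * τ k) (factor p τ r B C l) b := by
    cases b <;> simp only [siteMean, if_true, if_false, Bool.false_eq_true]
    · exact add_nonneg (mul_nonneg hq (hf _)) (mul_nonneg hq1.le (hf _))
    · exact hf _
  rcases l with _ | _
  · cases b
    · cases r
      · simpa [gain] using hs
      · have := mul_nonneg hq1.le (hf false)
        simp only [gain, siteMean, if_true, if_false, Bool.false_eq_true]
        simp only [factor, if_true] at this ⊢
        simpa using this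
    · simpa [gain] using hs
  · simpa [gain] using hs

-- An uncharged resampling is harmless once the event that an unlabelled required variable turns on
-- is removed. If the variable is not required, turning on only lowers its weight, since C ≤
-- (B-pC)/(1-p).
include hp0 hp1 hτ0 hτ1 hC hCB in
theorem siteMean_sub_gain_le (r : Bool) (l : Label m) (b : Bool) (k : Fin m) :
    siteMean (p * τ k) (factor p τ r B C l) b - gain p (τ k) r C l b ≤ factor p τ r B C l b := by
  have hf := factor_nonneg hp0 hp1 hτ0 hτ1 hC hCB r l false
  have hq := mul_nonneg hp0 (hτ0 k)
  have hfq := mul_nonneg hq hf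
  rcases l with _ | ⟨k', j⟩
  · cases b
    · cases r
      · have h1 : 0 < 1 - p := sub_pos.2 hp1
        have : C ≤ factor p τ false B C none false := by
          simp only [factor, if_false, Bool.false_eq_true]
          rw [le_div_iff₀ h1]
          linarith
        have h2 := mul_le_mul_of_nonneg_left this hq
        simp only [gain, siteMean, if_false, Bool.false_eq_true]
        have h3 : factor p τ false B C none true = C := rfl
        rw [h3]
        linarith
      · simp only [gain, siteMean, if_true, if_false, Bool.false_eq_true]
        have h3 : factor p τ true B C none true = C := rfl
        rw [h3]
        linarith
    · simp [gain, siteMean]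
  · cases b
    · have h3 : factor p τ r B C (some (k', j)) true = 0 := rfl
      simp only [gain, siteMean, if_false, Bool.false_eq_true]
      rw [h3]
      linarith
    · simp [gain, siteMean]

-- In the resampling that its label names, the variable turns on with weight pτ instead of staying
-- off with 1-pτ; hence the quotient in `factor`. The weight C that follows is relaxed to B.
include hp0 hp1 hτ0 hτ1 hC hCB in
theorem gain_mul_le_factor (r : Bool) (l : Label m) (b : Bool) (k : Fin m) (j : ℕ) :
    gain p (τ k) r C l b * (if b then 1 - τ k else 1) ≤
      factor p τ r ((1 - p * τ k) * B) ((1 - τ k) * C) (some (k, j)) b := by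
  have hq := mul_nonneg hp0 (hτ0 k)
  have hB := hC.trans hCB
  have hne := (one_sub_mul_pos hp0 hp1 hτ1 k).ne'
  cases b
  · have e : factor p τ r ((1 - p * τ k) * B) ((1 - τ k) * C) (some (k, j)) false =
        p * τ k * B := by
      simp only [factor, if_false, Bool.false_eq_true]
      field_simp
    rw [e]
    have h1 := mul_le_mul_of_nonneg_left hCB hq
    have h2 := mul_nonneg hq hB
    rcases l with _ | _ <;> cases r <;> simp [gain, h1, h2]
  · rcases l with _ | _ <;> simp [gain, factor]

/-- The weight of a label in the expectation over the initial sampling. -/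
def labelWeight (p : ℝ) (τ : Fin m → ℝ) (r : Bool) : Label m → ℝ
  | none => if r then p else 1
  | some (k, _) => p * τ k

-- Without a label this is the eigenvector identity, an equality. With a label the initial draw must
-- be zero, and (1-p)/(1-pτ) ≤ 1.
include hp0 hp1 hτ0 hτ1 hC hCB in
theorem mean_factor_le (r : Bool) (l : Label m) :
    p * factor p τ r B C l true + (1 - p) * factor p τ r B C l false ≤
      labelWeight p τ r l * B := by
  have h1 : 1 - p ≠ 0 := (sub_pos.2 hp1).ne'
  have hB := hC.trans hCB
  rcases l with _ | ⟨k, j⟩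
  · refine le_of_eq ?_
    cases r <;> simp only [factor, labelWeight, if_true, if_false, Bool.false_eq_true] <;>
      field_simp <;> ring
  · have hq := mul_nonneg (mul_nonneg hp0 (hτ0 k)) hB
    have hpos := one_sub_mul_pos hp0 hp1 hτ1 k
    simp only [factor, labelWeight, if_true, if_false, Bool.false_eq_true, mul_zero, zero_add]
    rw [← mul_div_assoc, div_le_iff₀ hpos, mul_comm]
    exact mul_le_mul_of_nonneg_left (by nlinarith [hτ1 k]) hq

end factor

/-! ### The potential function -/

theorem prod_pow_add_ite {ι : Type*} [Fintype ι] [DecidableEq ι] (f : ι → ℝ) {J J' : ι → ℕ} {k : ι}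
    (h : ∀ k', J' k' = J k' + if k' = k then 1 else 0) :
    ∏ k', f k' ^ J' k' = f k * ∏ k', f k' ^ J k' := by
  simp only [h, pow_add, prod_mul_distrib]
  rw [mul_comm]
  congr 1
  simp

/-- The weight of variable `i` under the labelling `c`. -/
def siteFactor {n m : ℕ} (p : Fin n → ℝ) (τ : Fin m → Fin n → ℝ) (R : Finset (Fin n))
    (c : Fin n → Label m) (i : Fin n) : Bool → ℝ :=
  factor (p i) (fun k => τ k i) (decide (i ∈ R)) (∏ k, (1 - p i * τ k i) ^ total c k)
    (∏ k, (1 - τ k i) ^ total c k) (c i)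

/-- A bound for the probability that, from the state `x` on, the variables in `R` are set to one in
the way that the labelling `c` prescribes. -/
def potential {n m : ℕ} (p : Fin n → ℝ) (τ : Fin m → Fin n → ℝ) (w : Fin m → ℝ)
    (R : Finset (Fin n)) (c : Fin n → Label m) (x : Fin n → Bool) : ℝ :=
  (∏ k, w k ^ total c k) * ∏ i, siteFactor p τ R c i (x i)

section potential

variable {n m : ℕ} {p : Fin n → ℝ} {τ : Fin m → Fin n → ℝ} {w : Fin m → ℝ}
  (hp0 : ∀ i, 0 ≤ p i) (hp1 : ∀ i, p i < 1) (hτ0 : ∀ k i, 0 ≤ τ k i) (hτ1 : ∀ k i, τ k i < 1)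
  (hw : ∀ k, 0 ≤ w k) {R : Finset (Fin n)} {K : Finset (Fin m)} {t : ℕ}

include hτ1 in
theorem onMass_nonneg (J : Fin m → ℕ) (i : Fin n) : 0 ≤ ∏ k, (1 - τ k i) ^ J k :=
  prod_nonneg fun k _ => pow_nonneg (sub_nonneg.2 (hτ1 k i).le) _

include hp1 hτ0 hτ1 in
theorem onMass_le_offMass (J : Fin m → ℕ) (i : Fin n) :
    ∏ k, (1 - τ k i) ^ J k ≤ ∏ k, (1 - p i * τ k i) ^ J k :=
  prod_le_prod (fun k _ => pow_nonneg (sub_nonneg.2 (hτ1 k i).le) _) fun k _ =>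
    pow_le_pow_left₀ (sub_nonneg.2 (hτ1 k i).le) (by nlinarith [hτ0 k i, hp1 i]) _

include hp0 hp1 hτ0 hτ1 in
theorem siteFactor_nonneg (c : Fin n → Label m) (i : Fin n) (b : Bool) :
    0 ≤ siteFactor p τ R c i b :=
  factor_nonneg (hp0 i) (hp1 i) (fun k => hτ0 k i) (fun k => hτ1 k i) (onMass_nonneg hτ1 _ i)
    (onMass_le_offMass hp1 hτ0 hτ1 _ i) _ _ _

include hp0 hp1 hτ0 hτ1 hw in
theorem potential_nonneg (c : Fin n → Label m) (x : Fin n → Bool) :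
    0 ≤ potential p τ w R c x :=
  mul_nonneg (prod_nonneg fun k _ => pow_nonneg (hw k) _)
    (prod_nonneg fun i _ => siteFactor_nonneg hp0 hp1 hτ0 hτ1 c i _)

include hp1 in
theorem siteFactor_of_total {c c' : Fin n → Label m} {k : Fin m}
    (h : ∀ k', total c' k' = total c k' + if k' = k then 1 else 0) (i : Fin n) (b : Bool)
    (hl : c' i = c i) :
    siteFactor p τ R c' i b =
      siteMean (p i * τ k i) (siteFactor p τ R c i) b * if b then 1 - τ k i else 1 := by
  rw [siteFactor, hl, prod_pow_add_ite _ h, prod_pow_add_ite _ h]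
  exact (siteMean_factor (hp1 i) (τ := fun k => τ k i) _ _ _ k).symm

include hp0 hp1 hτ0 hτ1 in
theorem siteMean_siteFactor_nonneg (c : Fin n → Label m) (k : Fin m) (i : Fin n) (b : Bool) :
    0 ≤ siteMean (p i * τ k i) (siteFactor p τ R c i) b :=
  (gain_nonneg (hp0 i) (fun k => hτ0 k i) (onMass_nonneg hτ1 _ i) _ _ _ k).trans
    (gain_le_siteMean (hp0 i) (hp1 i) (fun k => hτ0 k i) (fun k => hτ1 k i) (onMass_nonneg hτ1 _ i)
      (onMass_le_offMass hp1 hτ0 hτ1 _ i) _ _ _ k)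

include hw in
/-- Comparison of the expected weights before and after charging a resampling of a violated
constraint `k`. -/
theorem mul_prod_le_potential {c c' : Fin n → Label m} {k : Fin m} {x : Fin n → Bool}
    (hx : 1 ≤ w k * ∏ i, if x i then 1 - τ k i else 1)
    (h : ∀ k', total c' k' = total c k' + if k' = k then 1 else 0) {f : Fin n → ℝ}
    (hf0 : ∀ i, 0 ≤ f i)
    (hf : ∏ i, (f i * if x i then 1 - τ k i else 1) ≤ ∏ i, siteFactor p τ R c' i (x i)) :
    (∏ k, w k ^ total c k) * ∏ i, f i ≤ potential p τ w R c' x := by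
  have hW : 0 ≤ ∏ k, w k ^ total c k := prod_nonneg fun k _ => pow_nonneg (hw k) _
  have hP : 0 ≤ ∏ i, f i := prod_nonneg fun i _ => hf0 i
  rw [potential, prod_pow_add_ite _ h]
  calc (∏ k, w k ^ total c k) * ∏ i, f i
      ≤ ((∏ k, w k ^ total c k) * ∏ i, f i) * (w k * ∏ i, if x i then 1 - τ k i else 1) :=
        le_mul_of_one_le_right (mul_nonneg hW hP) hx
    _ = (w k * ∏ k, w k ^ total c k) * ∏ i, (f i * if x i then 1 - τ k i else 1) := by
        rw [prod_mul_distrib]; ring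
    _ ≤ _ := mul_le_mul_of_nonneg_left hf (mul_nonneg (hw k) hW)

-- Going back over a resampling of k, the labelling c can only come from those c' that `Label.dec k`
-- takes to c.
include hp0 hp1 hτ0 hτ1 hw in
theorem resample_potential_le {c : Fin n → Label m} (hc : c ∈ labellings R K t) {k : Fin m}
    (hk : k ∈ K) {x : Fin n → Bool} (hx : 1 ≤ w k * ∏ i, if x i then 1 - τ k i else 1) :
    (∏ k, w k ^ total c k) * ∏ i, siteMean (p i * τ k i) (siteFactor p τ R c i) (x i) ≤
      ∑ c' ∈ labellings R K (t + 1) with Label.dec k ∘ c' = c, potential p τ w R c' x := by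
  classical
  have hpot : ∀ c', 0 ≤ potential p τ w R c' x := fun c' =>
    potential_nonneg hp0 hp1 hτ0 hτ1 hw c' x
  have hcomp : ∀ i, (0 : ℝ) ≤ if x i then 1 - τ k i else 1 := fun i => by
    split_ifs
    exacts [sub_nonneg.2 (hτ1 k i).le, zero_le_one]
  have hmem := mem_labellings.1 hc
  by_cases hused : ∃ i, (c i).count k ≠ 0
  -- A later resampling of k is already labelled, so this one precedes it and is charged: the label
  -- (k, j) becomes (k, j+1).
  · obtain ⟨i, hi⟩ := hused
    obtain ⟨j, hj⟩ : ∃ j, c i = some (k, j) := by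
      rcases h : c i with _ | ⟨k', j⟩
      · simp [h, Label.count] at hi
      · by_cases e : k' = k
        · exact ⟨j, by rw [e]⟩
        · simp [h, Label.count, e] at hi
    have huniq : ∀ i', (c i').count k ≠ 0 → i' = i := fun i' hi' => hmem.2 k i' i hi' hi
    have hR := hmem.1 i k j hj
    have htot := total_update c i (some (k, j + 1)) k fun k' => by
      rw [hj]
      by_cases e : k' = k
      · simp [Label.count, e]
      · simp [Label.count, e, Ne.symm e]
    refine (mul_prod_le_potential hw hx htot
      (fun i => siteMean_siteFactor_nonneg hp0 hp1 hτ0 hτ1 c k i (x i))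
      (le_of_eq (prod_congr rfl fun i' _ => ?_))).trans
      (single_le_sum (f := fun c' => potential p τ w R c' x) (fun c' _ => hpot c')
        (mem_filter.2 ⟨update_mem_labellings hc hR.1 hk hR.2.2 huniq, dec_comp_update ?_ ?_⟩))
    · rcases eq_or_ne i' i with rfl | hne
      · refine (siteMean_factor (hp1 i') (τ := fun k => τ k i') _ _ _ k).trans ?_
        rw [siteFactor, Function.update_self, prod_pow_add_ite _ htot, prod_pow_add_ite _ htot, hj]
        rfl
      · exact (siteFactor_of_total hp1 htot i' _ (Function.update_of_ne hne _ _)).symm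
    · simp [Label.dec, hj]
    · exact fun i' hne => by_contra fun h => hne (huniq i' h)
  -- Nothing later refers to k. Either no unlabelled required variable turns on, and c is kept
  -- without a charge, or one that does receives the label (k, 0), with a charge.
  · push Not at hused
    set g : Fin n → ℝ := fun i =>
      gain (p i) (τ k i) (decide (i ∈ R)) (∏ k, (1 - τ k i) ^ total c k) (c i) (x i) with hg
    set M : Fin n → ℝ := fun i => siteMean (p i * τ k i) (siteFactor p τ R c i) (x i) with hM
    have hg0 : ∀ i, 0 ≤ g i := fun i =>
      gain_nonneg (hp0 i) (fun k => hτ0 k i) (onMass_nonneg hτ1 _ i) _ _ _ k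
    have hgM : ∀ i, g i ≤ M i := fun i =>
      gain_le_siteMean (hp0 i) (hp1 i) (fun k => hτ0 k i) (fun k => hτ1 k i)
        (onMass_nonneg hτ1 _ i) (onMass_le_offMass hp1 hτ0 hτ1 _ i) _ _ _ k
    have hM0 : ∀ i, 0 ≤ M i := fun i => (hg0 i).trans (hgM i)
    have hrest : ∀ i, M i - g i ≤ siteFactor p τ R c i (x i) := fun i =>
      siteMean_sub_gain_le (hp0 i) (hp1 i) (fun k => hτ0 k i) (fun k => hτ1 k i)
        (onMass_nonneg hτ1 _ i) (onMass_le_offMass hp1 hτ0 hτ1 _ i) _ _ _ k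
    have hW : 0 ≤ ∏ k, w k ^ total c k := prod_nonneg fun k _ => pow_nonneg (hw k) _
    -- All factors other than the labelled one keep their full mean M, so further required variables
    -- may turn on in the same resampling. This is why one label per constraint suffices.
    have hexp := prod_add_le_prod_add_sum univ g (fun i => M i - g i) (fun i _ => hg0 i)
      fun i _ => sub_nonneg.2 (hgM i)
    simp only [add_sub_cancel] at hexp
    have hzero : ∀ i, ¬ (i ∈ R ∧ c i = none) → g i = 0 := by
      intro i hi
      rcases h : c i with _ | _
      · have : i ∉ R := fun hR => hi ⟨hR, h⟩
        simp [hg, h, gain, this]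
      · simp [hg, h, gain]
    set U : Finset (Fin n) := univ.filter fun i => i ∈ R ∧ c i = none with hU
    set new : Fin n → Fin n → Label m := fun i => Function.update c i (some (k, 0)) with hnew
    have hterm : ∀ i ∈ U, (∏ k, w k ^ total c k) * (g i * ∏ j ∈ univ.erase i, M j) ≤
        potential p τ w R (new i) x := by
      intro i hi
      have hi' := (mem_filter.1 hi).2
      have htot := total_update c i (some (k, 0)) k fun k' => by
        rw [hi'.2]
        by_cases e : k' = k
        · simp [Label.count, e]
        · simp [Label.count, e, Ne.symm e]
      have hprod : g i * ∏ j ∈ univ.erase i, M j = ∏ j, Function.update M i (g i) j := by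
        rw [← mul_prod_erase univ _ (mem_univ i), Function.update_self]
        congr 1
        exact prod_congr rfl fun j hj => by rw [Function.update_of_ne (ne_of_mem_erase hj)]
      rw [hprod]
      refine mul_prod_le_potential hw hx htot (fun j => ?_) (prod_le_prod (fun j _ => ?_)
        fun j _ => ?_)
      · rcases eq_or_ne j i with rfl | hne
        · simpa using hg0 j
        · simpa [hne] using hM0 j
      · refine mul_nonneg ?_ (hcomp j)
        rcases eq_or_ne j i with rfl | hne
        · simpa using hg0 j
        · simpa [hne] using hM0 j
      · rcases eq_or_ne j i with rfl | hne
        · rw [Function.update_self, siteFactor, Function.update_self, prod_pow_add_ite _ htot,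
            prod_pow_add_ite _ htot]
          exact gain_mul_le_factor (hp0 j) (hp1 j) (fun k => hτ0 k j) (fun k => hτ1 k j)
            (onMass_nonneg hτ1 _ j) (onMass_le_offMass hp1 hτ0 hτ1 _ j) _ _ _ k 0
        · rw [Function.update_of_ne hne,
            siteFactor_of_total hp1 htot j _ (Function.update_of_ne hne _ _)]
    have hinj : Set.InjOn new U := by
      intro i hi i' hi' h
      by_contra hne
      have h1 := congrFun h i
      have h2 := (mem_filter.1 hi).2.2
      simp [hnew, Function.update_of_ne hne, h2] at h1
    have hcU : c ∉ U.image new := by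
      intro h
      obtain ⟨i, hi, e⟩ := mem_image.1 h
      have h1 := congrFun e i
      simp [hnew, (mem_filter.1 hi).2.2] at h1
    have hsub : insert c (U.image new) ⊆
        (labellings R K (t + 1)).filter fun c' => Label.dec k ∘ c' = c := by
      intro c' hc'
      rcases mem_insert.1 hc' with rfl | hc'
      · exact mem_filter.2 ⟨labellings_mono R K t.le_succ hc,
          funext fun i => Label.dec_of_count_eq_zero (hused i)⟩
      · obtain ⟨i, hi, rfl⟩ := mem_image.1 hc'
        have hi' := (mem_filter.1 hi).2
        exact mem_filter.2 ⟨update_mem_labellings hc hi'.1 hk t.zero_le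
          fun i' h => absurd (hused i') h,
          dec_comp_update (by simp [Label.dec, hi'.2]) fun i' _ => hused i'⟩
    calc (∏ k, w k ^ total c k) * ∏ i, M i
        ≤ (∏ k, w k ^ total c k) * (∏ i, (M i - g i) + ∑ i, g i * ∏ j ∈ univ.erase i, M j) :=
          mul_le_mul_of_nonneg_left hexp hW
      _ = (∏ k, w k ^ total c k) * ∏ i, (M i - g i) +
            ∑ i ∈ U, (∏ k, w k ^ total c k) * (g i * ∏ j ∈ univ.erase i, M j) := by
          rw [mul_add, mul_sum, hU, sum_filter_of_ne]
          intro i _ h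
          by_contra hi
          exact h (by rw [hzero i hi]; ring)
      _ ≤ potential p τ w R c x + ∑ i ∈ U, potential p τ w R (new i) x :=
          add_le_add (mul_le_mul_of_nonneg_left
            (prod_le_prod (fun i _ => sub_nonneg.2 (hgM i)) fun i _ => hrest i) hW)
            (sum_le_sum hterm)
      _ = ∑ c' ∈ insert c (U.image new), potential p τ w R c' x := by
          rw [sum_insert hcU, sum_image hinj]
      _ ≤ _ := sum_le_sum_of_subset_of_nonneg hsub fun c' _ _ => hpot c'

include hp0 hp1 hτ0 hτ1 hw in
/-- One resampling of a violated constraint does not increase the total potential, up to one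
more resampling allowed in the labellings. -/
theorem sum_resample_potential_le {k : Fin m} (hk : k ∈ K) {x : Fin n → Bool}
    (hx : 1 ≤ w k * ∏ i, if x i then 1 - τ k i else 1) :
    ∑ c ∈ labellings R K t,
        (∏ k, w k ^ total c k) * ∏ i, siteMean (p i * τ k i) (siteFactor p τ R c i) (x i) ≤
      ∑ c ∈ labellings R K (t + 1), potential p τ w R c x := by
  classical
  refine (sum_le_sum fun c hc => resample_potential_le hp0 hp1 hτ0 hτ1 hw hc hk hx).trans ?_
  -- Different c have disjoint fibres under `Label.dec k`, so no c' is counted twice.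
  convert sum_fiberwise_le_sum_of_sum_fiber_nonneg fun c _ =>
    sum_nonneg fun c' _ => potential_nonneg hp0 hp1 hτ0 hτ1 hw c' x

/-- With no resampling left, only the empty labelling remains; then B = C = 1, and a required
variable has weight 1 if on and 0 if off. -/
theorem indicator_le_sum_potential (hp1 : ∀ i, p i < 1) (x : Fin n → Bool) :
    {x : Fin n → Bool | ∀ i ∈ R, x i = true}.indicator (1 : (Fin n → Bool) → ℝ) x ≤
      ∑ c ∈ labellings R K 0, potential p τ w R c x := by
  classical
  have hlab : labellings R K 0 = {fun _ => none} := by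
    ext c
    rw [mem_labellings, mem_singleton]
    constructor
    · intro h
      funext i
      rcases e : c i with _ | ⟨k, j⟩
      · rfl
      · exact absurd (h.1 i k j e).2.2 (Nat.not_lt_zero j)
    · rintro rfl
      exact ⟨fun i k j e => by simp at e, fun k i i' h => absurd rfl h⟩
  have htot : ∀ k : Fin m, total (fun _ : Fin n => (none : Label m)) k = 0 := fun k => by
    simp [total, Label.count]
  have hsite : ∀ i, siteFactor p τ R (fun _ => none) i (x i) =
      if i ∈ R then (if x i then 1 else 0) else 1 := by
    intro i
    have := (sub_pos.2 (hp1 i)).ne'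
    by_cases hi : i ∈ R <;> cases h : x i <;> simp [siteFactor, htot, factor, hi, div_self this]
  rw [hlab, sum_singleton, potential]
  simp only [hsite, htot, pow_zero, prod_const_one, one_mul]
  by_cases h : ∀ i ∈ R, x i = true
  · rw [Set.indicator_of_mem (Set.mem_ofPred.2 h), prod_eq_one, Pi.one_apply]
    intro i _
    split_ifs with h1 h2
    · rfl
    · exact absurd (h i h1) h2
    · rfl
  · rw [Set.indicator_of_notMem (Set.mem_ofPred.not.2 h)]
    exact prod_nonneg fun i _ => by split_ifs <;> norm_num

include hp0 hp1 hτ0 hτ1 hw in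
/-- The bound for the total expected potential after the initial sampling. -/
theorem sum_expect_potential_le :
    ∑ c ∈ labellings R K t, (∏ k, w k ^ total c k) *
        ∏ i, (p i * siteFactor p τ R c i true + (1 - p i) * siteFactor p τ R c i false) ≤
      ∏ i ∈ R, (p i * (1 + ∑ k ∈ K, τ k i *
        ∑ j ∈ range t, (w k * ∏ i', (1 - p i' * τ k i')) ^ (j + 1))) := by
  classical
  set s : Fin m → ℝ := fun k => w k * ∏ i', (1 - p i' * τ k i') with hs
  have hq : ∀ k i, 0 ≤ 1 - p i * τ k i := fun k i =>
    (one_sub_mul_pos (hp0 i) (hp1 i) (τ := fun k => τ k i) (fun k => hτ1 k i) k).le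
  have hs0 : ∀ k, 0 ≤ s k := fun k => mul_nonneg (hw k) (prod_nonneg fun i _ => hq k i)
  set ψ : Fin n → Label m → ℝ := fun i l =>
    labelWeight (p i) (fun k => τ k i) (decide (i ∈ R)) l * ∏ k, s k ^ l.count k with hψ
  have hlw : ∀ i l, 0 ≤ labelWeight (p i) (fun k => τ k i) (decide (i ∈ R)) l := by
    intro i l
    rcases l with _ | ⟨k, j⟩
    · simp only [labelWeight]
      split_ifs
      exacts [hp0 i, zero_le_one]
    · exact mul_nonneg (hp0 i) (hτ0 k i)
  have hψ0 : ∀ i l, 0 ≤ ψ i l := fun i l =>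
    mul_nonneg (hlw i l) (prod_nonneg fun k _ => pow_nonneg (hs0 k) _)
  have hterm : ∀ c : Fin n → Label m, (∏ k, w k ^ total c k) *
      ∏ i, (p i * siteFactor p τ R c i true + (1 - p i) * siteFactor p τ R c i false) ≤
      ∏ i, ψ i (c i) := by
    intro c
    have h1 : ∏ i, ψ i (c i) = (∏ k, w k ^ total c k) *
        ∏ i, (labelWeight (p i) (fun k => τ k i) (decide (i ∈ R)) (c i) *
          ∏ k, (1 - p i * τ k i) ^ total c k) := by
      have h2 : ∏ i, ∏ k, s k ^ (c i).count k = ∏ k, s k ^ total c k := by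
        rw [prod_comm]
        exact prod_congr rfl fun k _ => prod_pow_eq_pow_sum _ _ _
      have h3 : ∏ i, ∏ k, (1 - p i * τ k i) ^ total c k =
          ∏ k, (∏ i, (1 - p i * τ k i)) ^ total c k := by
        rw [prod_comm]
        exact prod_congr rfl fun k _ => prod_pow _ _ _
      rw [hψ, prod_mul_distrib, prod_mul_distrib, h2, h3]
      simp only [hs, mul_pow, prod_mul_distrib]
      ring
    rw [h1]
    refine mul_le_mul_of_nonneg_left (prod_le_prod (fun i _ => ?_) fun i _ => ?_)
      (prod_nonneg fun k _ => pow_nonneg (hw k) _)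
    · exact add_nonneg (mul_nonneg (hp0 i) (siteFactor_nonneg hp0 hp1 hτ0 hτ1 c i _))
        (mul_nonneg (sub_nonneg.2 (hp1 i).le) (siteFactor_nonneg hp0 hp1 hτ0 hτ1 c i _))
    · exact mean_factor_le (hp0 i) (hp1 i) (fun k => hτ0 k i) (fun k => hτ1 k i)
        (onMass_nonneg hτ1 _ i) (onMass_le_offMass hp1 hτ0 hτ1 _ i) _ _
  refine (sum_le_sum fun c _ => hterm c).trans ?_
  rw [labellings]
  -- Dropping the condition of one variable per constraint makes the labels independent, so the sum
  -- factors over the variables.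
  refine (sum_le_sum_of_subset_of_nonneg (filter_subset _ _)
    fun c _ _ => prod_nonneg fun i _ => hψ0 i _).trans ?_
  rw [← prod_univ_sum, ← prod_subset (subset_univ R)]
  · refine le_of_eq (prod_congr rfl fun i hi => ?_)
    have hpow : ∀ (k : Fin m) (j : ℕ), ∏ k', s k' ^ Label.count k' (some (k, j)) =
        s k ^ (j + 1) := by
      intro k j
      rw [prod_eq_single k]
      · simp [Label.count]
      · intro k' _ hne
        simp [Label.count, hne.symm]
      · simp
    have hnone : ∀ k : Fin m, Label.count k none = 0 := fun _ => rfl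
    rw [if_pos hi, sum_insertNone, sum_product]
    simp only [hψ, hpow, labelWeight, hi, decide_true, if_true, hnone, pow_zero,
      prod_const_one, mul_one, mul_add, mul_sum, mul_assoc]
    rfl
  · intro i _ hi
    simp [hi, hψ, labelWeight, Label.count]

end potential

/-! ### Application to RELAXATION: charging, one-step inequality and geometric series -/

section algorithm

variable {n m : ℕ} {A : Fin m → Fin n → ℝ} {a : Fin m → ℝ} {xhat : Fin n → ℝ} {σ α : ℝ}
  (hA : ∀ k i, A k i ∈ Set.Icc (0 : ℝ) 1) (hσ : σ ∈ Set.Ioo (0 : ℝ) 1)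
  (hα : -Real.log (1 - σ) / σ < α) (hx : ∀ i, xhat i ∈ Set.Ico (0 : ℝ) (1 / α))
  (hcover : ∀ k, a k ≤ fracRowValue A k xhat)

include hσ hα in
theorem one_lt_of_neg_log_div_lt : 1 < α := by
  refine lt_of_le_of_lt ?_ hα
  rw [le_div_iff₀ hσ.1, one_mul]
  linarith [Real.log_le_sub_one_of_pos (sub_pos.2 hσ.2)]

include hσ hα hx in
theorem initial_mem_Ico (i : Fin n) : α * xhat i ∈ Set.Ico (0 : ℝ) 1 := by
  have h : 0 < α := zero_lt_one.trans (one_lt_of_neg_log_div_lt hσ hα)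
  refine ⟨mul_nonneg h.le (hx i).1, ?_⟩
  have := (lt_div_iff₀ h).1 (hx i).2
  linarith

include hA hσ in
theorem scaled_mem_Ico (k : Fin m) (i : Fin n) : σ * A k i ∈ Set.Ico (0 : ℝ) 1 :=
  ⟨mul_nonneg hσ.1.le (hA k i).1, by nlinarith [(hA k i).1, (hA k i).2, hσ.1, hσ.2]⟩

-- Justifies restricting labels to constraints with a_k > 0; for the others the geometric series
-- might diverge.
include hA in
theorem pos_of_violated {k : Fin m} {x : Fin n → Bool} (h : rowValue A k x < a k) : 0 < a k := by
  refine lt_of_le_of_lt (sum_nonneg fun i _ => mul_nonneg (hA k i).1 ?_) h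
  split_ifs <;> norm_num

include hA hσ in
theorem one_le_weight_of_violated {k : Fin m} {x : Fin n → Bool} (h : rowValue A k x < a k) :
    1 ≤ (1 - σ) ^ (-a k) * ∏ i, if x i then 1 - σ * A k i else 1 := by
  have h0 : 0 < 1 - σ := sub_pos.2 hσ.2
  have h1 : (1 - σ) ^ rowValue A k x ≤ ∏ i, if x i then 1 - σ * A k i else 1 := by
    rw [rowValue, Real.rpow_sum_of_pos h0]
    refine prod_le_prod (fun i _ => Real.rpow_nonneg h0.le _) fun i _ => ?_
    split_ifs
    -- Bernoulli's inequality (1-σ)^A ≤ 1-σA for A ∈ [0,1].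
    · have := rpow_one_add_le_one_add_mul_self (s := -σ) (by linarith [hσ.2]) (hA k i).1 (hA k i).2
      rw [mul_one, show 1 - σ * A k i = 1 + A k i * -σ by ring, sub_eq_add_neg]
      exact this
    · simp
  calc (1 : ℝ) = (1 - σ) ^ (-a k) * (1 - σ) ^ a k := by rw [← Real.rpow_add h0]; simp
    _ ≤ _ := mul_le_mul_of_nonneg_left
      ((Real.rpow_le_rpow_of_exponent_ge h0 (by linarith [hσ.1]) h.le).trans h1)
      (Real.rpow_nonneg h0.le _)

include hA hσ hα hx in
theorem resample_mem_Ico (k : Fin m) (i : Fin n) :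
    σ * A k i * α * xhat i ∈ Set.Ico (0 : ℝ) 1 := by
  have h1 := scaled_mem_Ico hA hσ k i
  have h2 := initial_mem_Ico hσ hα hx i
  rw [mul_assoc]
  exact ⟨mul_nonneg h1.1 h2.1, mul_lt_one_of_nonneg_of_lt_one_left h1.1 h1.2 h2.2.le⟩

/-- The potential of the state of the algorithm when at most `t` more resamplings of each
constraint are accounted for. -/
def totalPotential {n m : ℕ} (xhat : Fin n → ℝ) (A : Fin m → Fin n → ℝ) (a : Fin m → ℝ) (σ α : ℝ)
    (R : Finset (Fin n)) (t : ℕ) (x : Fin n → Bool) : ℝ :=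
  ∑ c ∈ labellings R {k | 0 < a k} t,
    potential (fun i => α * xhat i) (fun k i => σ * A k i) (fun k => (1 - σ) ^ (-a k)) R c x

include hA hσ hα hx in
theorem expect_step_totalPotential_le (R : Finset (Fin n)) (t : ℕ) (x : Fin n → Bool) :
    expect (step xhat A a σ α x) (totalPotential xhat A a σ α R t) ≤
      totalPotential xhat A a σ α R (t + 1) x := by
  have hp := initial_mem_Ico hσ hα hx
  have hτ := scaled_mem_Ico hA hσ
  have hw : ∀ k, 0 ≤ (1 - σ) ^ (-a k) := fun k => Real.rpow_nonneg (sub_pos.2 hσ.2).le _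
  rw [step]
  split_ifs with h
  · set k := (violated A a x).min' h
    have hk : rowValue A k x < a k := (mem_filter.1 (min'_mem _ h)).2
    have hq := resample_mem_Ico hA hσ hα hx k
    have hle := sum_resample_potential_le (R := R) (K := ({k | 0 < a k} : Finset (Fin m)))
      (t := t) (fun i => (hp i).1) (fun i => (hp i).2) (fun k i => (hτ k i).1)
      (fun k i => (hτ k i).2) hw (mem_filter.2 ⟨mem_univ k, pos_of_violated hA hk⟩)
      (one_le_weight_of_violated hA hσ hk)
    refine le_trans (le_of_eq ?_) hle
    unfold totalPotential potential
    rw [expect_sum]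
    refine sum_congr rfl fun c _ => ?_
    rw [expect_const_mul, expect_resample_prod (fun i => (hq i).1) fun i => (hq i).2.le]
    refine congrArg _ (prod_congr rfl fun i _ => ?_)
    congr 1
    ring
  · rw [expect_pure]
    exact sum_le_sum_of_subset_of_nonneg (labellings_mono _ _ t.le_succ) fun c _ _ =>
      potential_nonneg (fun i => (hp i).1) (fun i => (hp i).2) (fun k i => (hτ k i).1)
        (fun k i => (hτ k i).2) hw c x

include hA hσ hα hx in
theorem expect_run_totalPotential_le (R : Finset (Fin n)) (t s : ℕ) :
    expect (run xhat A a σ α t) (totalPotential xhat A a σ α R s) ≤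
      expect (run xhat A a σ α 0) (totalPotential xhat A a σ α R (s + t)) := by
  induction t generalizing s with
  | zero => exact le_rfl
  | succ t ih =>
    rw [show run xhat A a σ α (t + 1) = (run xhat A a σ α t).bind (step xhat A a σ α) from rfl,
      expect_bind]
    refine (expect_mono _ (expect_step_totalPotential_le hA hσ hα hx R s)).trans ?_
    have h := ih (s + 1)
    rwa [show s + 1 + t = s + (t + 1) by omega] at h

/-- The expected factor that one resampling of constraint `k` contributes is at most
`((1 - σ) ^ a_k * exp (σ α A_k · xhat))⁻¹`. -/
theorem weight_mul_prod_le (hσ : σ ∈ Set.Ioo (0 : ℝ) 1)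
    (hq : ∀ k i, α * xhat i * (σ * A k i) ≤ 1) (k : Fin m) :
    (1 - σ) ^ (-a k) * ∏ i, (1 - α * xhat i * (σ * A k i)) ≤
      ((1 - σ) ^ a k * Real.exp (σ * α * fracRowValue A k xhat))⁻¹ := by
  have h0 : 0 < 1 - σ := sub_pos.2 hσ.2
  have he : (Real.exp (σ * α * fracRowValue A k xhat))⁻¹ =
      ∏ i, Real.exp (-(α * xhat i * (σ * A k i))) := by
    rw [← Real.exp_neg, ← Real.exp_sum, fracRowValue, mul_sum, ← sum_neg_distrib]
    refine congrArg _ (sum_congr rfl fun i _ => by ring)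
  rw [Real.rpow_neg h0.le, mul_inv, he]
  exact mul_le_mul_of_nonneg_left (prod_le_prod (fun i _ => sub_nonneg.2 (hq k i))
    fun i _ => Real.one_sub_le_exp_neg _) (inv_nonneg.2 (Real.rpow_nonneg h0.le _))

-- The logarithm is at least a_k (ln(1-σ) + σα), and the lower bound on α says precisely that the
-- bracket is positive.
include hσ hα hcover in
theorem one_lt_denominator {k : Fin m} (hk : 0 < a k) :
    1 < (1 - σ) ^ a k * Real.exp (σ * α * fracRowValue A k xhat) := by
  have h0 : 0 < 1 - σ := sub_pos.2 hσ.2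
  rw [Real.rpow_def_of_pos h0, ← Real.exp_add, Real.one_lt_exp_iff]
  have h1 : -Real.log (1 - σ) < σ * α := by
    have := (div_lt_iff₀ hσ.1).1 hα
    linarith
  have h2 : 0 < σ * α := mul_pos hσ.1 (zero_lt_one.trans (one_lt_of_neg_log_div_lt hσ hα))
  nlinarith [hcover k]

-- Such a constraint is never resampled, so its summand in ρ_i need only be nonnegative. Equality is
-- possible; division by zero then gives the summand 0.
include hA hσ hα hx in
theorem one_le_denominator {k : Fin m} (hk : a k ≤ 0) :
    1 ≤ (1 - σ) ^ a k * Real.exp (σ * α * fracRowValue A k xhat) := by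
  have h2 : 0 < σ * α := mul_pos hσ.1 (zero_lt_one.trans (one_lt_of_neg_log_div_lt hσ hα))
  have h3 : 0 ≤ fracRowValue A k xhat := sum_nonneg fun i _ => mul_nonneg (hA k i).1 (hx i).1
  exact one_le_mul_of_one_le_of_one_le
    (Real.one_le_rpow_of_pos_of_le_one_of_nonpos (sub_pos.2 hσ.2) (by linarith [hσ.1]) hk)
    (Real.one_le_exp (mul_nonneg h2.le h3))

theorem sum_pow_succ_le {s d : ℝ} (hs : 0 ≤ s) (hd : 1 < d) (h : s ≤ d⁻¹) (t : ℕ) :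
    ∑ j ∈ range t, s ^ (j + 1) ≤ 1 / (d - 1) := by
  have hd0 : 0 < d := zero_lt_one.trans hd
  have hr1 : d⁻¹ < 1 := inv_lt_one_of_one_lt₀ hd
  calc ∑ j ∈ range t, s ^ (j + 1) ≤ ∑ j ∈ range t, d⁻¹ * d⁻¹ ^ j :=
        sum_le_sum fun j _ => by rw [← pow_succ']; exact pow_le_pow_left₀ hs h _
    _ = d⁻¹ * ∑ j ∈ range t, d⁻¹ ^ j := by rw [mul_sum]
    _ ≤ d⁻¹ * (1 - d⁻¹)⁻¹ := by
        refine mul_le_mul_of_nonneg_left ?_ (inv_nonneg.2 hd0.le)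
        rw [← tsum_geometric_of_lt_one (inv_nonneg.2 hd0.le) hr1]
        exact (summable_geometric_of_lt_one (inv_nonneg.2 hd0.le) hr1).sum_le_tsum _
          fun j _ => pow_nonneg (inv_nonneg.2 hd0.le) j
    _ = 1 / (d - 1) := by
        have : d - 1 ≠ 0 := (sub_pos.2 hd).ne'
        field_simp

include hA hσ hα hx hcover in
theorem expect_initial_totalPotential_le (R : Finset (Fin n)) (t : ℕ) :
    expect (run xhat A a σ α 0) (totalPotential xhat A a σ α R t) ≤
      ∏ i ∈ R, rho xhat A a σ α i := by
  have hp := initial_mem_Ico hσ hα hx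
  have hτ := scaled_mem_Ico hA hσ
  have hw : ∀ k, 0 ≤ (1 - σ) ^ (-a k) := fun k => Real.rpow_nonneg (sub_pos.2 hσ.2).le _
  have hq : ∀ k i, α * xhat i * (σ * A k i) ≤ 1 := fun k i => by
    nlinarith [(hp i).1, (hp i).2, (hτ k i).1, (hτ k i).2]
  set s : Fin m → ℝ := fun k => (1 - σ) ^ (-a k) * ∏ i, (1 - α * xhat i * (σ * A k i)) with hs
  have hs0 : ∀ k, 0 ≤ s k := fun k =>
    mul_nonneg (hw k) (prod_nonneg fun i _ => sub_nonneg.2 (hq k i))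
  have hle := sum_expect_potential_le (R := R) (K := ({k | 0 < a k} : Finset (Fin m)))
    (t := t) (fun i => (hp i).1) (fun i => (hp i).2) (fun k i => (hτ k i).1)
    (fun k i => (hτ k i).2) hw
  have hE : expect (run xhat A a σ α 0) (totalPotential xhat A a σ α R t) ≤ ∏ i ∈ R,
      (α * xhat i * (1 + ∑ k with 0 < a k, σ * A k i * ∑ j ∈ range t, s k ^ (j + 1))) := by
    refine le_trans (le_of_eq ?_) hle
    unfold totalPotential potential
    rw [run]
    rw [expect_sum]
    refine sum_congr rfl fun c _ => ?_
    rw [expect_const_mul, expect_independentBernoulli_prod (fun i => (hp i).1)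
      fun i => (hp i).2.le]
  refine hE.trans (prod_le_prod (fun i _ => mul_nonneg (hp i).1 (add_nonneg zero_le_one
    (sum_nonneg fun k _ => mul_nonneg (hτ k i).1
      (sum_nonneg fun j _ => pow_nonneg (hs0 k) _)))) fun i _ => ?_)
  rw [rho]
  refine mul_le_mul_of_nonneg_left (add_le_add le_rfl ?_) (hp i).1
  rw [mul_sum]
  refine (sum_le_sum fun k hk => ?_).trans
    (sum_le_sum_of_subset_of_nonneg (subset_univ _) fun k _ hk => ?_)
  · rw [mul_assoc, div_eq_mul_one_div]
    exact mul_le_mul_of_nonneg_left (mul_le_mul_of_nonneg_left (sum_pow_succ_le (hs0 k)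
      (one_lt_denominator hσ hα hcover (mem_filter.1 hk).2)
      (weight_mul_prod_le hσ hq k) t) (hA k i).1) hσ.1.le
  · have hk' : a k ≤ 0 := by simpa using hk
    exact mul_nonneg hσ.1.le (div_nonneg (hA k i).1
      (sub_nonneg.2 (one_le_denominator hA hσ hα hx hk')))

include hA hσ hα hx hcover in
theorem outputProb_upperCylinder_le (R : Finset (Fin n)) :
    outputProb xhat A a σ α {x | ∀ i ∈ R, x i = true} ≤
      ENNReal.ofReal (∏ i ∈ R, rho xhat A a σ α i) := by
  refine iSup_le fun t => ?_
  rw [toOuterMeasure_eq_expect]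
  refine ENNReal.ofReal_le_ofReal ?_
  refine (expect_mono _ fun x => ?_).trans ((expect_run_totalPotential_le hA hσ hα hx R t 0).trans
    (expect_initial_totalPotential_le hA hσ hα hx hcover R _))
  refine le_trans ?_ (indicator_le_sum_potential (fun i => (initial_mem_Ico hσ hα hx i).2) x)
  exact Set.indicator_le_indicator_of_subset (fun y hy => hy.2) (fun _ => zero_le_one) x

/-! ### Termination -/

/-- The number of variables that are zero. -/
def zeros {n : ℕ} (x : Fin n → Bool) : ℝ := ∑ i, if x i then 0 else 1

-- Some zero variable must have a positive chance to turn on: otherwise A_k·x̂ is supported on the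
-- ones of x, and x̂ ≤ 1 gives A_k·x̂ ≤ A_k·x < a_k, against the covering hypothesis.
include hA hσ hα hx hcover in
theorem expect_step_zeros_lt {x : Fin n → Bool} (h : (violated A a x).Nonempty) :
    expect (step xhat A a σ α x) zeros < zeros x := by
  rw [step, dif_pos h]
  set k := (violated A a x).min' h
  have hk : rowValue A k x < a k := (mem_filter.1 (min'_mem _ h)).2
  have hq := resample_mem_Ico hA hσ hα hx k
  have hα1 := one_lt_of_neg_log_div_lt hσ hα
  have hα0 := zero_lt_one.trans hα1
  have hE : expect (resample xhat A σ α k x) zeros =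
      ∑ i, (1 - σ * A k i * α * xhat i) * (if x i then 0 else 1) := by
    unfold zeros
    rw [expect_sum]
    refine sum_congr rfl fun i _ => ?_
    rw [resample, expect_independentBernoulli_apply (f := fun b => if b then (0 : ℝ) else 1)]
    · cases h : x i <;> simp
    · intro i; split_ifs; exacts [zero_le_one, (hq i).1]
    · intro i; split_ifs; exacts [le_rfl, (hq i).2.le]
  rw [hE, zeros]
  obtain ⟨i, hi, hpos⟩ : ∃ i, x i = false ∧ 0 < A k i * xhat i := by
    by_contra! hno
    refine absurd (hcover k) (not_le.2 (lt_of_le_of_lt (sum_le_sum fun i _ => ?_) hk))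
    cases hxi : x i
    · simpa using hno i hxi
    · have : xhat i ≤ 1 := (hx i).2.le.trans ((div_le_one hα0).2 hα1.le)
      simpa using mul_le_mul_of_nonneg_left this (hA k i).1
  refine sum_lt_sum (fun i _ => mul_le_of_le_one_left ?_ ?_) ⟨i, mem_univ i, ?_⟩
  · split_ifs <;> norm_num
  · linarith [(hq i).1]
  · have := mul_pos (mul_pos hσ.1 hα0) hpos
    simp only [hi, Bool.false_eq_true, if_false, mul_one]
    nlinarith

include hA hσ hα hx hcover in
theorem exists_drift : ∃ δ > 0, ∀ x : Fin n → Bool, expect (step xhat A a σ α x) zeros ≤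
    zeros x - δ * {x | (violated A a x).Nonempty}.indicator 1 x := by
  classical
  have hlt := fun x (h : (violated A a x).Nonempty) => expect_step_zeros_lt hA hσ hα hx hcover h
  obtain ⟨δ, hδ, h⟩ : ∃ δ > 0, ∀ x : Fin n → Bool, (violated A a x).Nonempty →
      δ ≤ zeros x - expect (step xhat A a σ α x) zeros := by
    -- The state space is finite, so the least drop over the violating states is a uniform δ.
    rcases (univ.filter fun x => (violated A a x).Nonempty).eq_empty_or_nonempty with he | hne
    · exact ⟨1, one_pos, fun x h => absurd (mem_filter.2 ⟨mem_univ x, h⟩) (he ▸ notMem_empty x)⟩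
    · obtain ⟨y, hy, hmin⟩ := exists_min_image _
        (fun x => zeros x - expect (step xhat A a σ α x) zeros) hne
      exact ⟨_, sub_pos.2 (hlt y (mem_filter.1 hy).2), fun x h =>
        hmin x (mem_filter.2 ⟨mem_univ x, h⟩)⟩
  refine ⟨δ, hδ, fun x => ?_⟩
  by_cases hv : (violated A a x).Nonempty
  · rw [Set.indicator_of_mem (by exact hv), Pi.one_apply]
    linarith [h x hv]
  · rw [Set.indicator_of_notMem (by exact hv), step, dif_neg hv, expect_pure]
    simp

-- The total drop in the expected number of zeros is bounded, so the probabilities of still running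
-- are summable and tend to zero.
include hA hσ hα hx hcover in
theorem outputProb_univ : outputProb xhat A a σ α Set.univ = 1 := by
  obtain ⟨δ, hδ, hdrift⟩ := exists_drift hA hσ hα hx hcover
  set v : ℕ → ℝ := fun t => expect (run xhat A a σ α t)
    ({x | (violated A a x).Nonempty}.indicator 1) with hv
  have hind : ∀ x, (0 : ℝ) ≤ {x | (violated A a x).Nonempty}.indicator 1 x :=
    Set.indicator_nonneg fun _ _ => zero_le_one
  have hv0 : ∀ t, 0 ≤ v t := fun t => expect_nonneg _ hind
  have hz0 : ∀ x : Fin n → Bool, 0 ≤ zeros x := fun x =>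
    sum_nonneg fun i _ => by split_ifs <;> norm_num
  have hsum : ∀ t, expect (run xhat A a σ α t) zeros + δ * ∑ s ∈ range t, v s ≤
      expect (run xhat A a σ α 0) zeros := by
    intro t
    induction t with
    | zero => simp
    | succ t ih =>
      have h1 : expect (run xhat A a σ α (t + 1)) zeros ≤
          expect (run xhat A a σ α t) zeros - δ * v t := by
        rw [run, expect_bind, hv, ← expect_const_mul, ← expect_sub]
        exact expect_mono _ hdrift
      rw [sum_range_succ, mul_add]
      linarith
  have hsummable : Summable v := by
    refine summable_of_sum_range_le (c := expect (run xhat A a σ α 0) zeros / δ) hv0 fun t => ?_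
    rw [le_div_iff₀ hδ]
    have := expect_nonneg (run xhat A a σ α t) hz0
    linarith [hsum t]
  have hterm : ∀ t, (run xhat A a σ α t).toOuterMeasure
      {x | violated A a x = ∅ ∧ x ∈ Set.univ} = ENNReal.ofReal (1 - v t) := by
    intro t
    rw [toOuterMeasure_eq_expect, ← expect_one (run xhat A a σ α t), hv, ← expect_sub]
    congr 2
    funext x
    rcases (violated A a x).eq_empty_or_nonempty with h | h
    · simp [h]
    · simp [h, h.ne_empty]
  have hlim : Filter.Tendsto (fun t => ENNReal.ofReal (1 - v t)) Filter.atTop (nhds 1) := by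
    have := ENNReal.tendsto_ofReal (hsummable.tendsto_atTop_zero.const_sub 1)
    simpa using this
  rw [outputProb]
  simp only [hterm]
  refine le_antisymm (iSup_le fun t => ?_)
    (le_of_tendsto' hlim fun t => le_iSup (fun t => ENNReal.ofReal (1 - v t)) t)
  rw [ENNReal.ofReal_le_one]
  linarith [hv0 t]

end algorithm

end

end CoveringLP

theorem theorem7p3 (n m : ℕ) (A : Fin m → Fin n → ℝ) (a : Fin m → ℝ) (xhat : Fin n → ℝ)
    (σ α : ℝ)
    (hA : ∀ k i, A k i ∈ Set.Icc (0 : ℝ) 1)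
    (hσ : σ ∈ Set.Ioo (0 : ℝ) 1)
    (hα : -Real.log (1 - σ) / σ < α)
    (hx : ∀ i, xhat i ∈ Set.Ico (0 : ℝ) (1 / α))
    (hcover : ∀ k, a k ≤ CoveringLP.fracRowValue A k xhat) :
    -- RELAXATION halts with probability one
    CoveringLP.outputProb xhat A a σ α Set.univ = 1 ∧
    -- and its output has the upper-cylinder property
    ∀ R : Finset (Fin n),
      CoveringLP.outputProb xhat A a σ α {x | ∀ i ∈ R, x i = true} ≤
        ENNReal.ofReal (∏ i ∈ R, CoveringLP.rho xhat A a σ α i) :=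
  ⟨CoveringLP.outputProb_univ hA hσ hα hx hcover,
    CoveringLP.outputProb_upperCylinder_le hA hσ hα hx hcover⟩
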